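/- **Kochen–Specker Theorem.** Let $H$ be a complex Hilbert space of (finite or infinite) dimension greater than $2$. Let $\mathrm{Obs}$ be a set of densely defined, possibly unbounded, self-adjoint operators on $H$ that contains every bounded self-adjoint operator (for example, the set of all self-adjoint operators on $H$). For $A\in\mathrm{Obs}$ let $\sigma(A)$ denote the spectrum of $A$, and for a Borel function $f:\mathbb{R}\to\mathbb{R}$ let $f(A)=\int f\,d\mu_A$ be the operator given by the Borel functional calculus, where $\mu_A$ is the spectral measure of $A$. Then there is no map $\lambda:\mathrm{Obs}\to\mathbb{R}$ such that \[ \lambda(A)\in\sigma(A)\quad\text{for all } A\in\mathrm{Obs}, \qquad \lambda(f(A))=f(\lambda(A))\quad\text{for all } A\in\mathrm{Obs}\text{ and all Borel functions } f \text{ with } f(A)\in\mathrm{Obs}. \] -/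

import Mathlib

namespace KochenSpecker

open MeasureTheory

variable {H : Type*} [NormedAddCommGroup H] [InnerProductSpace ℂ H]

/-- The spectrum of a (possibly unbounded) operator `A` with domain `A.domain`: the number `a` lies
outside the spectrum iff `A - a` has an everywhere defined bounded two-sided inverse `R`, that is
`(A - a) R = 1` on `H` and `R (A - a) = 1` on the domain of `A`. -/
def opSpectrum (A : H →ₗ.[ℂ] H) : Set ℂ :=
  {a | ¬ ∃ R : H →L[ℂ] H,
      (∀ x : H, ∃ h : R x ∈ A.domain, A ⟨R x, h⟩ - a • R x = x) ∧
      (∀ y : A.domain, R (A y - a • (y : H)) = y)}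

variable [CompleteSpace H]

/-- Projection-valued measures on the Borel subsets of `ℝ`. The values on sets that are not Borel
are irrelevant. Countable additivity is in the strong operator topology. -/
structure SpectralMeasure (H : Type*) [NormedAddCommGroup H] [InnerProductSpace ℂ H]
    [CompleteSpace H] where
  /-- the projection attached to a set -/
  proj : Set ℝ → (H →L[ℂ] H)
  isProj : ∀ s, MeasurableSet s → IsStarProjection (proj s)
  proj_empty : proj ∅ = 0
  proj_univ : proj Set.univ = 1
  proj_inter : ∀ s t, MeasurableSet s → MeasurableSet t → proj (s ∩ t) = proj s * proj t
  hasSum_proj : ∀ s : ℕ → Set ℝ, (∀ i, MeasurableSet (s i)) →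
    Pairwise (fun i j => Disjoint (s i) (s j)) →
    ∀ x : H, HasSum (fun i => proj (s i) x) (proj (⋃ i, s i) x)

namespace SpectralMeasure

theorem re_inner_proj_nonneg (E : SpectralMeasure H) (x : H) {s : Set ℝ} (hs : MeasurableSet s) :
    0 ≤ (inner ℂ x (E.proj s x)).re := by
  have h := E.isProj s hs
  have h1 : E.proj s x = E.proj s (E.proj s x) := by
    conv_lhs => rw [← h.isIdempotentElem.eq]
    rfl
  have h2 : inner ℂ x (E.proj s (E.proj s x)) = inner ℂ (E.proj s x) (E.proj s x) := by
    rw [← ContinuousLinearMap.adjoint_inner_left, h.isSelfAdjoint.adjoint_eq]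
  rw [h1, h2]
  exact inner_self_nonneg (𝕜 := ℂ)

/-- The positive measure `s ↦ ⟪x, E(s) x⟫` on `ℝ`. -/
noncomputable def measureAt (E : SpectralMeasure H) (x : H) : Measure ℝ :=
  Measure.ofMeasurable (fun s _ => ENNReal.ofReal (inner ℂ x (E.proj s x)).re)
    (by simp [E.proj_empty])
    (by
      intro s hs hd
      have h1 : HasSum (fun i => (inner ℂ x (E.proj (s i) x)).re)
          (inner ℂ x (E.proj (⋃ i, s i) x)).re :=
        Complex.hasSum_re ((E.hasSum_proj s hs hd x).mapL (innerSL ℂ x))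
      rw [← h1.tsum_eq]
      exact ENNReal.ofReal_tsum_of_nonneg (fun i => E.re_inner_proj_nonneg x (hs i)) h1.summable)

/-- `B` is the operator `∫ f dE`: its domain consists of the `x` with `∫ |f|² d⟪x, E x⟫ < ∞`, and
`⟪x, B x⟫ = ∫ f d⟪x, E x⟫` for such `x` (by polarization this determines `B`). -/
def IsIntegral (E : SpectralMeasure H) (f : ℝ → ℝ) (B : H →ₗ.[ℂ] H) : Prop :=
  (∀ x : H, x ∈ B.domain ↔ ∫⁻ t, ENNReal.ofReal (f t ^ 2) ∂(E.measureAt x) < ⊤) ∧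
  ∀ x : B.domain, inner ℂ (x : H) (B x) = ((∫ t, f t ∂(E.measureAt (x : H)) : ℝ) : ℂ)

end SpectralMeasure

/-- `B = f(A)` in the sense of the Borel functional calculus: `A = ∫ t dE(t)` for a
(necessarily unique) spectral measure `E`, and `B = ∫ f(t) dE(t)`. -/
def IsBorelFunctionOf (f : ℝ → ℝ) (A B : H →ₗ.[ℂ] H) : Prop :=
  ∃ E : SpectralMeasure H, E.IsIntegral (fun t => t) A ∧ E.IsIntegral f B

/-- A set of observables: it consists of self-adjoint (densely defined, possibly unbounded)
operators and contains all bounded self-adjoint operators. -/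
structure IsObservableSet (Obs : Set (H →ₗ.[ℂ] H)) : Prop where
  isSelfAdjoint : ∀ A ∈ Obs, IsSelfAdjoint A
  bounded_mem : ∀ T : H →L[ℂ] H, IsSelfAdjoint T → (T : H →ₗ[ℂ] H).toPMap ⊤ ∈ Obs

/-- The set of valuation functions on the set `Obs` of observables: maps `v : Obs → ℝ` with
`v A ∈ σ(A)` and `v (f(A)) = f (v A)` for all Borel functions `f`. -/
def valuations (Obs : Set (H →ₗ.[ℂ] H)) : Set (Obs → ℝ) :=
  {v | (∀ A : Obs, ((v A : ℝ) : ℂ) ∈ opSpectrum (A : H →ₗ.[ℂ] H)) ∧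
    ∀ (A B : Obs) (f : ℝ → ℝ), Measurable f →
      IsBorelFunctionOf f (A : H →ₗ.[ℂ] H) (B : H →ₗ.[ℂ] H) → v B = f (v A)}

end KochenSpecker

/-! A valuation makes an exclusive choice in every finite resolution of the identity `P i`. All the
`P i` are Borel functions of one observable `∑ i • P i`, so exactly one of them gets the value 1
(`exists_isTruthValuation`). The value of a projection does not depend on the resolution containing
it, and this is what fails. Three isometries `V i : L → H` with orthogonal ranges act as coordinate
axes: each direction in `ℝ³` gives a projection, and every orthonormal frame gives three projections
with the same sum. If the complement of that sum has value 0, integer directions acquire a colouring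
with exactly one coloured vector per orthogonal frame, which `not_isColoring` excludes. It remains
to find such a triple. In finite dimension take `L = ℂ` and three basis vectors, one of them with
value 1. In infinite dimension `H ≅ H³`, so the complement is 0. -/

namespace KochenSpecker

/-! ### Colourings of integer directions -/

/-- A Kochen–Specker colouring of the nonzero vectors of `ℤ³`: every orthogonal frame contains
exactly one coloured vector. -/
def IsColoring (c : (Fin 3 → ℤ) → Prop) : Prop :=
  ∀ u v w : Fin 3 → ℤ, u ≠ 0 → v ≠ 0 → w ≠ 0 → u ⬝ᵥ v = 0 → u ⬝ᵥ w = 0 → v ⬝ᵥ w = 0 →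
    (c u ∨ c v ∨ c w) ∧ ¬ (c u ∧ c v)

namespace IsColoring

variable {c : (Fin 3 → ℤ) → Prop}

/-- Integer isometries preserve orthogonality, so colourings pull back along them. This moves
`not_diagonal` to any pair of axes and signs. -/
theorem comp_frame (hc : IsColoring c) {p q r : Fin 3 → ℤ} (hp : p ⬝ᵥ p = 1) (hq : q ⬝ᵥ q = 1)
    (hr : r ⬝ᵥ r = 1) (hpq : p ⬝ᵥ q = 0) (hpr : p ⬝ᵥ r = 0) (hqr : q ⬝ᵥ r = 0) :
    IsColoring fun u => c (u 0 • p + u 1 • q + u 2 • r) := by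
  have key (u v : Fin 3 → ℤ) :
      (u 0 • p + u 1 • q + u 2 • r) ⬝ᵥ (v 0 • p + v 1 • q + v 2 • r) = u ⬝ᵥ v := by
    simp only [dotProduct_add, add_dotProduct, smul_dotProduct, dotProduct_smul, hp, hq, hr, hpq,
      hpr, hqr, dotProduct_comm q p, dotProduct_comm r p, dotProduct_comm r q, smul_eq_mul]
    simp only [dotProduct, Fin.sum_univ_three]
    ring
  have key0 {u : Fin 3 → ℤ} (hu : u ≠ 0) : u 0 • p + u 1 • q + u 2 • r ≠ 0 := by
    intro h
    exact hu (dotProduct_self_eq_zero.1 (by rw [← key, h, zero_dotProduct]))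
  intro u v w hu hv hw huv huw hvw
  exact hc _ _ _ (key0 hu) (key0 hv) (key0 hw) (by rwa [key]) (by rwa [key]) (by rwa [key])

/-- Two coloured vectors cannot enclose an angle of 45 degrees. -/
theorem not_diagonal (hc : IsColoring c) (h1 : c ![0, 0, 1]) (h2 : c ![0, 1, 1]) : False := by
  -- `off`: a coloured vector excludes its orthogonals, with `w` completing the frame. `on`: two
  -- uncoloured vectors force the third. The steps below come in pairs exchanged, up to sign, by
  -- reflecting the first coordinate.
  have off (u v w : Fin 3 → ℤ) (hu : c u)
      (h : u ≠ 0 ∧ v ≠ 0 ∧ w ≠ 0 ∧ u ⬝ᵥ v = 0 ∧ u ⬝ᵥ w = 0 ∧ v ⬝ᵥ w = 0) : ¬ c v := fun hv =>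
    (hc u v w h.1 h.2.1 h.2.2.1 h.2.2.2.1 h.2.2.2.2.1 h.2.2.2.2.2).2 ⟨hu, hv⟩
  have on (u v w : Fin 3 → ℤ) (hu : ¬ c u) (hv : ¬ c v)
      (h : u ≠ 0 ∧ v ≠ 0 ∧ w ≠ 0 ∧ u ⬝ᵥ v = 0 ∧ u ⬝ᵥ w = 0 ∧ v ⬝ᵥ w = 0) : c w :=
    ((hc u v w h.1 h.2.1 h.2.2.1 h.2.2.2.1 h.2.2.2.2.1 h.2.2.2.2.2).1.resolve_left hu).resolve_left
      hv
  have a1 := off _ ![0, 1, 0] ![1, 0, 0] h1 (by decide)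
  have a2 := off _ ![1, -1, 0] ![1, 1, 0] h1 (by decide)
  have a3 := off _ ![1, 1, 0] ![1, -1, 0] h1 (by decide)
  have a4 := off _ ![0, 1, -1] ![1, 0, 0] h2 (by decide)
  have a5 := off _ ![1, -1, 1] ![2, 1, -1] h2 (by decide)
  have a6 := off _ ![1, 1, -1] ![2, -1, 1] h2 (by decide)
  have b1 := on _ _ ![1, -1, -2] a5 a3 (by decide)
  have b2 := on _ _ ![1, 1, 2] a2 a6 (by decide)
  have a7 := off _ ![2, 0, 1] ![1, 5, -2] b1 (by decide)
  have a8 := off _ ![2, 0, -1] ![1, -5, 2] b2 (by decide)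
  have b3 := on _ _ ![1, 0, -2] a1 a7 (by decide)
  have b4 := on _ _ ![1, 0, 2] a1 a8 (by decide)
  have a9 := off _ ![2, 1, 1] ![2, -5, 1] b3 (by decide)
  have a10 := off _ ![2, -1, -1] ![2, 5, -1] b4 (by decide)
  have b5 := on _ _ ![1, -1, -1] a4 a9 (by decide)
  have b6 := on _ _ ![1, 1, 1] a4 a10 (by decide)
  have a11 := off _ ![1, 0, 1] ![1, 2, -1] b5 (by decide)
  have a12 := off _ ![1, 0, -1] ![1, -2, 1] b6 (by decide)
  exact a1 (on _ _ ![0, 1, 0] a11 a12 (by decide))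

end IsColoring

/-- Some axis `r` is coloured, so another axis `p` is not. The frame `p, q + r, -q + r` then has a
coloured diagonal at 45 degrees to `r`. -/
theorem not_isColoring (c : (Fin 3 → ℤ) → Prop) : ¬ IsColoring c := by
  intro hc
  have key (p q r : Fin 3 → ℤ) (h : p ⬝ᵥ p = 1 ∧ q ⬝ᵥ q = 1 ∧ r ⬝ᵥ r = 1 ∧ p ⬝ᵥ q = 0 ∧
      p ⬝ᵥ r = 0 ∧ q ⬝ᵥ r = 0) (h1 : c r) (h2 : c (q + r)) : False :=
    (hc.comp_frame h.1 h.2.1 h.2.2.1 h.2.2.2.1 h.2.2.2.2.1 h.2.2.2.2.2).not_diagonal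
      (by simpa using h1) (by simpa using h2)
  have on_axis (p q r : Fin 3 → ℤ) (h : p ⬝ᵥ p = 1 ∧ q ⬝ᵥ q = 1 ∧ r ⬝ᵥ r = 1 ∧ p ⬝ᵥ q = 0 ∧
      p ⬝ᵥ r = 0 ∧ q ⬝ᵥ r = 0) (h1 : c r) (h' : p ≠ 0 ∧ q + r ≠ 0 ∧ -q + r ≠ 0 ∧ r ≠ 0 ∧ q ≠ 0 ∧
      p ⬝ᵥ (q + r) = 0 ∧ p ⬝ᵥ (-q + r) = 0 ∧ (q + r) ⬝ᵥ (-q + r) = 0) : False := by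
    have hp : ¬ c p := fun hp => (hc p r q h'.1 h'.2.2.2.1 h'.2.2.2.2.1 h.2.2.2.2.1 h.2.2.2.1
      (by rw [dotProduct_comm]; exact h.2.2.2.2.2)).2 ⟨hp, h1⟩
    rcases (hc p (q + r) (-q + r) h'.1 h'.2.1 h'.2.2.1 h'.2.2.2.2.2.1 h'.2.2.2.2.2.2.1
      h'.2.2.2.2.2.2.2).1 with h0 | h0 | h0
    · exact hp h0
    · exact key p q r h h1 h0
    · exact key p (-q) r (by simpa using h) h1 h0
  rcases (hc ![1, 0, 0] ![0, 1, 0] ![0, 0, 1] (by decide) (by decide) (by decide) (by decide)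
    (by decide) (by decide)).1 with h | h | h
  · exact on_axis ![0, 1, 0] ![0, 0, 1] ![1, 0, 0] (by decide) h (by decide)
  · exact on_axis ![0, 0, 1] ![1, 0, 0] ![0, 1, 0] (by decide) h (by decide)
  · exact on_axis ![1, 0, 0] ![0, 1, 0] ![0, 0, 1] (by decide) h (by decide)

/-! ### Finite resolutions of the identity and their functional calculus -/

open MeasureTheory

variable {H : Type*} [NormedAddCommGroup H] [InnerProductSpace ℂ H] [CompleteSpace H]

/-- A finite resolution of the identity by pairwise orthogonal projections. -/
structure IsResolution {ι : Type*} [Fintype ι] (P : ι → (H →L[ℂ] H)) : Prop where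
  isProj : ∀ i, IsStarProjection (P i)
  mul_eq_zero : ∀ i j, i ≠ j → P i * P j = 0
  sum_eq_one : ∑ i, P i = 1

namespace IsResolution

variable {ι : Type*} [Fintype ι] {P : ι → (H →L[ℂ] H)}

open Classical in
theorem mul_eq_ite (hP : IsResolution P) (i j : ι) : P i * P j = if i = j then P i else 0 := by
  split_ifs with h
  · subst h
    exact (hP.isProj i).isIdempotentElem.eq
  · exact hP.mul_eq_zero i j h

open Classical in
theorem sum_ite_mul_sum_ite (hP : IsResolution P) (p q : ι → Prop) :
    (∑ i, if p i then P i else 0) * (∑ i, if q i then P i else 0) =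
      ∑ i, if p i ∧ q i then P i else 0 := by
  rw [Finset.sum_mul_sum]
  refine Finset.sum_congr rfl fun i _ => ?_
  rw [Finset.sum_eq_single i]
  · by_cases h1 : p i <;> by_cases h2 : q i <;> simp [h1, h2, hP.mul_eq_ite]
  · intro j _ hj
    by_cases h1 : p i <;> by_cases h2 : q j <;> simp [h1, h2, hP.mul_eq_zero i j hj.symm]
  · simp

open Classical in
/-- The spectral measure with the mass `P i` at the point `a i`. -/
noncomputable def spectralMeasure (hP : IsResolution P) (a : ι → ℝ) : SpectralMeasure H where
  proj s := ∑ i, if a i ∈ s then P i else 0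
  isProj s _ := by
    refine ⟨?_, ?_⟩
    · simp only [IsIdempotentElem, hP.sum_ite_mul_sum_ite, and_self]
    · rw [IsSelfAdjoint, star_sum]
      refine Finset.sum_congr rfl fun i _ => ?_
      split_ifs
      · exact (hP.isProj i).isSelfAdjoint.star_eq
      · exact star_zero _
  proj_empty := by simp
  proj_univ := by simp [hP.sum_eq_one]
  proj_inter s t _ _ := by simp only [hP.sum_ite_mul_sum_ite, Set.mem_inter_iff]
  hasSum_proj s _ hd x := by
    simp only [sum_apply]
    refine hasSum_sum fun i _ => ?_
    by_cases h : ∃ k, a i ∈ s k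
    · obtain ⟨k, hk⟩ := h
      rw [if_pos (Set.mem_iUnion.2 ⟨k, hk⟩)]
      have := hasSum_single (f := fun j => (if a i ∈ s j then P i else 0 : H →L[ℂ] H) x) k
        (fun j hj => by
          rw [if_neg fun h' => Set.disjoint_left.1 (hd hj) h' hk]
          rfl)
      simpa [hk] using this
    · push Not at h
      simp [h, hasSum_zero]

theorem inner_apply_self (hP : IsResolution P) (x : H) (i : ι) :
    inner ℂ x (P i x) = ((‖P i x‖ ^ 2 : ℝ) : ℂ) := by
  have h := hP.isProj i
  have h1 : P i x = P i (P i x) := by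
    conv_lhs => rw [← h.isIdempotentElem.eq]
    rfl
  rw [h1, ← ContinuousLinearMap.adjoint_inner_left, h.isSelfAdjoint.adjoint_eq,
    inner_self_eq_norm_sq_to_K, ← h1]
  norm_cast

theorem measureAt_eq (hP : IsResolution P) (a : ι → ℝ) (x : H) :
    (hP.spectralMeasure a).measureAt x =
      ∑ i, ENNReal.ofReal (‖P i x‖ ^ 2) • Measure.dirac (a i) := by
  classical
  ext s hs
  rw [SpectralMeasure.measureAt, Measure.ofMeasurable_apply s hs]
  simp only [spectralMeasure, sum_apply, inner_sum, Complex.re_sum,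
    Measure.coe_finsetSum, Finset.sum_apply, Measure.smul_apply, smul_eq_mul]
  rw [ENNReal.ofReal_sum_of_nonneg]
  · refine Finset.sum_congr rfl fun i _ => ?_
    by_cases h : a i ∈ s
    · simp only [h, if_true, hP.inner_apply_self, Complex.ofReal_re,
        Measure.dirac_apply' _ hs, Set.indicator_of_mem, Pi.one_apply, mul_one]
    · simp [h, Measure.dirac_apply' _ hs]
  · intro i _
    by_cases h : a i ∈ s
    · simp only [h, if_true, hP.inner_apply_self, Complex.ofReal_re]
      positivity
    · simp [h]

/-- `∑ i, f (a i) • P i` as an everywhere defined operator is the integral of `f`. -/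
theorem isIntegral (hP : IsResolution P) (a : ι → ℝ) (f : ℝ → ℝ) :
    (hP.spectralMeasure a).IsIntegral f
      (((∑ i, (f (a i) : ℂ) • P i : H →L[ℂ] H) : H →ₗ[ℂ] H).toPMap ⊤) := by
  refine ⟨fun x => ?_, fun x => ?_⟩
  · have : ∫⁻ t, ENNReal.ofReal (f t ^ 2) ∂((hP.spectralMeasure a).measureAt x) < ⊤ := by
      rw [hP.measureAt_eq, lintegral_finsetSum_measure]
      refine ENNReal.sum_lt_top.2 fun i _ => ?_
      rw [lintegral_smul_measure, lintegral_dirac]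
      exact ENNReal.mul_lt_top ENNReal.ofReal_lt_top ENNReal.ofReal_lt_top
    simpa using this
  · rw [hP.measureAt_eq, integral_finsetSum_measure]
    · change inner ℂ (x : H) ((∑ i, (f (a i) : ℂ) • P i) (x : H)) = _
      simp only [sum_apply, inner_sum,
        smul_apply, inner_smul_right, hP.inner_apply_self,
        integral_smul_measure, integral_dirac]
      push_cast
      refine Finset.sum_congr rfl fun i _ => ?_
      rw [ENNReal.toReal_ofReal (by positivity)]
      push_cast [smul_eq_mul]
      ring
    · intro i _
      exact (integrable_dirac (by simp)).smul_measure ENNReal.ofReal_ne_top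

end IsResolution

omit [CompleteSpace H] in
-- For `a ≠ 0` the resolvent is `-a⁻¹`. The spectral condition on valuations enters only here.
theorem zero_of_mem_opSpectrum_zero {a : ℂ}
    (ha : a ∈ opSpectrum (((0 : H →L[ℂ] H) : H →ₗ[ℂ] H).toPMap ⊤)) : a = 0 := by
  by_contra h
  refine ha ⟨-a⁻¹ • (1 : H →L[ℂ] H), fun x => ⟨trivial, ?_⟩, fun y => ?_⟩
  · change (0 : H) - a • (-a⁻¹ • x) = x
    simp [smul_smul, h]
  · change -a⁻¹ • ((0 : H) - a • (y : H)) = y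
    simp [smul_smul, h]

/-! ### From valuations to truth values of projections -/

/-- A dispersion-free assignment of truth values to the projections: in every finite resolution of
the identity, exactly one projection gets the value `1`. -/
def IsTruthValuation (w : (H →L[ℂ] H) → ℝ) : Prop :=
  ∀ (n : ℕ) (P : Fin n → (H →L[ℂ] H)), IsResolution P →
    ∃ i, w (P i) = 1 ∧ ∀ j, j ≠ i → w (P j) = 0

theorem exists_isTruthValuation {Obs : Set (H →ₗ.[ℂ] H)} (hObs : IsObservableSet Obs)
    {v : Obs → ℝ} (hv : v ∈ valuations Obs) : ∃ w : (H →L[ℂ] H) → ℝ, IsTruthValuation w := by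
  classical
  let w : (H →L[ℂ] H) → ℝ := fun T =>
    if h : (T : H →ₗ[ℂ] H).toPMap ⊤ ∈ Obs then v ⟨_, h⟩ else 0
  have hw {T : H →L[ℂ] H} (hT : IsSelfAdjoint T) : w T = v ⟨_, hObs.bounded_mem T hT⟩ :=
    dif_pos (hObs.bounded_mem T hT)
  have hw0 : w 0 = 0 := by
    rw [hw (IsSelfAdjoint.zero _)]
    exact_mod_cast zero_of_mem_opSpectrum_zero (hv.1 ⟨_, hObs.bounded_mem 0 (.zero _)⟩)
  refine ⟨w, fun n P hP => ?_⟩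
  let a : Fin n → ℝ := fun i => ((i : ℕ) : ℝ)
  have ha : Function.Injective a := fun i j h => Fin.ext (Nat.cast_injective h)
  let S : (ℝ → ℝ) → (H →L[ℂ] H) := fun f => ∑ i, (f (a i) : ℂ) • P i
  have hS (f : ℝ → ℝ) : IsSelfAdjoint (S f) := by
    rw [IsSelfAdjoint, star_sum]
    refine Finset.sum_congr rfl fun i _ => ?_
    rw [star_smul, (hP.isProj i).isSelfAdjoint.star_eq, Complex.star_def, Complex.conj_ofReal]
  have hf (f : ℝ → ℝ) (hf : Measurable f) : w (S f) = f (w (S id)) := by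
    rw [hw (hS f), hw (hS id)]
    exact hv.2 _ _ f hf ⟨hP.spectralMeasure a, hP.isIntegral a id, hP.isIntegral a f⟩
  -- Otherwise the indicator of the complement of `Set.range a` is 1 at this value, although that
  -- function of the observable is the zero operator, whose value is 0.
  have hmem : w (S id) ∈ Set.range a := by
    by_contra hn
    have h1 := hf ((Set.range a)ᶜ.indicator 1)
      (measurable_one.indicator (Set.finite_range a).measurableSet.compl)
    have h2 : S ((Set.range a)ᶜ.indicator 1) = 0 := by simp [S]
    rw [h2, hw0, Set.indicator_of_mem hn] at h1
    exact zero_ne_one h1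
  have hPi (i : Fin n) : w (P i) = ({a i} : Set ℝ).indicator 1 (w (S id)) := by
    rw [← hf _ (measurable_one.indicator (measurableSet_singleton _))]
    congr 1
    simp only [S, Set.indicator_apply, Set.mem_singleton_iff, ha.eq_iff]
    simp
  obtain ⟨i, hi⟩ := hmem
  refine ⟨i, by simp [hPi, ← hi], fun j hj => ?_⟩
  rw [hPi, ← hi, Set.indicator_of_notMem]
  simpa [ha.eq_iff] using hj.symm

theorem IsTruthValuation.exists_of_fintype {w : (H →L[ℂ] H) → ℝ} (hw : IsTruthValuation w)
    {ι : Type*} [Fintype ι] {P : ι → (H →L[ℂ] H)} (hP : IsResolution P) :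
    ∃ i, w (P i) = 1 ∧ ∀ j, j ≠ i → w (P j) = 0 := by
  have h : IsResolution (P ∘ (Fintype.equivFin ι).symm) :=
    ⟨fun i => hP.isProj _, fun i j hij => hP.mul_eq_zero _ _ (by simpa using hij),
      by rw [← hP.sum_eq_one]; exact (Fintype.equivFin ι).symm.sum_comp P⟩
  obtain ⟨i, hi, hj⟩ := hw _ _ h
  refine ⟨(Fintype.equivFin ι).symm i, hi, fun j hji => ?_⟩
  have := hj (Fintype.equivFin ι j) (by rwa [Ne, ← Equiv.eq_symm_apply])
  simpa using this

/-- Completing a finite family of pairwise orthogonal projections by the complement of its sum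
gives a resolution of the identity. -/
theorem IsResolution.of_orthogonal {ι : Type*} [Fintype ι] {P : ι → (H →L[ℂ] H)}
    (hP : ∀ i, IsStarProjection (P i)) (hmul : ∀ i j, i ≠ j → P i * P j = 0) :
    IsResolution fun o : Option ι => o.elim (1 - ∑ i, P i) P := by
  classical
  have hl (j : ι) : (∑ i, P i) * P j = P j := by
    rw [Finset.sum_mul, Finset.sum_eq_single j (fun i _ h => hmul i j h) (by simp)]
    exact (hP j).isIdempotentElem.eq
  have hr (j : ι) : P j * ∑ i, P i = P j := by
    rw [Finset.mul_sum, Finset.sum_eq_single j (fun i _ h => hmul j i h.symm) (by simp)]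
    exact (hP j).isIdempotentElem.eq
  have hsum : IsStarProjection (∑ i, P i) :=
    ⟨by rw [IsIdempotentElem, Finset.sum_mul]; exact Finset.sum_congr rfl fun i _ => hr i,
      by rw [IsSelfAdjoint, star_sum]
         exact Finset.sum_congr rfl fun i _ => (hP i).isSelfAdjoint.star_eq⟩
  refine ⟨?_, ?_, ?_⟩
  · rintro (_ | i)
    · exact hsum.one_sub
    · exact hP i
  · rintro (_ | i) (_ | j) hij
    · exact absurd rfl hij
    · simp [sub_mul, hl]
    · simp [mul_sub, hr]
    · exact hmul i j fun h => hij (congrArg some h)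
  · simp [Fintype.sum_option]

/-! ### Rotating a triple of isometries -/

section Frame

variable {L : Type*} [NormedAddCommGroup L] [InnerProductSpace ℂ L] [CompleteSpace L]

open ContinuousLinearMap (adjoint)

/-- Isometries of `L` into `H` with pairwise orthogonal ranges. -/
def IsIsometricFamily {ι : Type*} (V : ι → (L →L[ℂ] H)) : Prop :=
  (∀ i, adjoint (V i) ∘L V i = .id ℂ L) ∧ ∀ i j, i ≠ j → adjoint (V i) ∘L V j = 0

namespace IsIsometricFamily

theorem isStarProjection {ι : Type*} {V : ι → (L →L[ℂ] H)} (hV : IsIsometricFamily V) (i : ι) :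
    IsStarProjection (V i ∘L adjoint (V i) : H →L[ℂ] H) := by
  refine ⟨?_, ?_⟩
  · change (V i ∘L adjoint (V i)) ∘L (V i ∘L adjoint (V i)) = _
    rw [ContinuousLinearMap.comp_assoc, ← ContinuousLinearMap.comp_assoc (adjoint (V i)), hV.1,
      ContinuousLinearMap.id_comp]
  · rw [ContinuousLinearMap.isSelfAdjoint_iff', ContinuousLinearMap.adjoint_comp,
      ContinuousLinearMap.adjoint_adjoint]

theorem mul_eq_zero {ι : Type*} {V : ι → (L →L[ℂ] H)} (hV : IsIsometricFamily V) (i j : ι)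
    (hij : i ≠ j) : (V i ∘L adjoint (V i) : H →L[ℂ] H) * (V j ∘L adjoint (V j)) = 0 := by
  change (V i ∘L adjoint (V i)) ∘L (V j ∘L adjoint (V j)) = _
  rw [ContinuousLinearMap.comp_assoc, ← ContinuousLinearMap.comp_assoc (adjoint (V i)),
    hV.2 i j hij, ContinuousLinearMap.zero_comp, ContinuousLinearMap.comp_zero]

theorem adjoint_comp_eq_ite {V : Fin 3 → (L →L[ℂ] H)} (hV : IsIsometricFamily V) (i j : Fin 3) :
    adjoint (V i) ∘L V j = if i = j then .id ℂ L else 0 := by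
  split_ifs with h
  · subst h; exact hV.1 i
  · exact hV.2 i j h

end IsIsometricFamily

/-- The combination of three operators with real coefficients. -/
noncomputable def combination (V : Fin 3 → (L →L[ℂ] H)) (a : Fin 3 → ℝ) : L →L[ℂ] H :=
  ∑ i, (a i : ℂ) • V i

theorem adjoint_combination (V : Fin 3 → (L →L[ℂ] H)) (a : Fin 3 → ℝ) :
    adjoint (combination V a) = ∑ i, (a i : ℂ) • adjoint (V i) := by
  simp only [combination, map_sum, map_smulₛₗ, Complex.conj_ofReal]

theorem IsIsometricFamily.combination {V : Fin 3 → (L →L[ℂ] H)} (hV : IsIsometricFamily V)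
    {ι : Type*} {e : ι → Fin 3 → ℝ} (he : ∀ k, e k ⬝ᵥ e k = 1)
    (he' : ∀ k l, k ≠ l → e k ⬝ᵥ e l = 0) :
    IsIsometricFamily fun k => combination V (e k) := by
  have key (k l : ι) : adjoint (KochenSpecker.combination V (e k)) ∘L
      KochenSpecker.combination V (e l) = ((e k ⬝ᵥ e l : ℝ) : ℂ) • .id ℂ L := by
    ext x
    have h (i j : Fin 3) (x : L) : adjoint (V i) (V j x) = if i = j then x else 0 := by
      have := congrArg (fun T => T x) (hV.adjoint_comp_eq_ite i j)
      split_ifs with hij <;> simpa [hij] using this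
    rw [adjoint_combination]
    simp [KochenSpecker.combination, Fin.sum_univ_three, h, dotProduct, smul_smul, ← add_smul,
      mul_comm, -Complex.coe_smul]
  refine ⟨fun k => ?_, fun k l hkl => ?_⟩
  · simp [key, he]
  · simp [key, he' k l hkl]

/-- The rows of a square matrix are orthonormal, hence so are its columns, and the cross terms
cancel. -/
theorem sum_combination_comp_adjoint (V : Fin 3 → (L →L[ℂ] H)) {e : Fin 3 → Fin 3 → ℝ}
    (he : ∀ k, e k ⬝ᵥ e k = 1) (he' : ∀ k l, k ≠ l → e k ⬝ᵥ e l = 0) :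
    ∑ k, (combination V (e k) ∘L adjoint (combination V (e k)) : H →L[ℂ] H) =
      ∑ i, V i ∘L adjoint (V i) := by
  have hM : Matrix.of e * (Matrix.of e).transpose = 1 := by
    ext k l
    rw [Matrix.one_apply, Matrix.mul_apply]
    split_ifs with h
    · subst h; exact he k
    · exact he' k l h
  have hM' (i j : Fin 3) : ∑ k, (e k i : ℂ) * e k j = if i = j then 1 else 0 := by
    have := congrArg (fun N : Matrix (Fin 3) (Fin 3) ℝ => N i j) (mul_eq_one_comm.1 hM)
    rw [Matrix.mul_apply, Matrix.one_apply] at this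
    have h2 := congrArg (fun r : ℝ => (r : ℂ)) this
    split_ifs at h2 ⊢ <;> simpa using h2
  ext x
  calc (∑ k, (combination V (e k) ∘L adjoint (combination V (e k)) : H →L[ℂ] H)) x
      = ∑ i, ∑ j, (∑ k, (e k i : ℂ) * e k j) • V i (adjoint (V j) x) := by
        simp only [adjoint_combination]
        simp [combination, Fin.sum_univ_three, smul_smul, add_smul, -Complex.coe_smul]
        module
    _ = _ := by simp [hM']

end Frame

/-! ### Contradiction from a triple of isometries -/

/-- The normalization of an integer vector. -/
noncomputable def unitVector (u : Fin 3 → ℤ) : Fin 3 → ℝ :=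
  fun i => u i / √((u ⬝ᵥ u : ℤ) : ℝ)

theorem unitVector_dotProduct (u v : Fin 3 → ℤ) : unitVector u ⬝ᵥ unitVector v =
    ((u ⬝ᵥ v : ℤ) : ℝ) / (√((u ⬝ᵥ u : ℤ) : ℝ) * √((v ⬝ᵥ v : ℤ) : ℝ)) := by
  simp only [unitVector, dotProduct, div_mul_div_comm, ← Finset.sum_div]
  push_cast
  rfl

theorem unitVector_dotProduct_self {u : Fin 3 → ℤ} (hu : u ≠ 0) :
    unitVector u ⬝ᵥ unitVector u = 1 := by
  have h1 : 0 ≤ u ⬝ᵥ u := Finset.sum_nonneg fun i _ => mul_self_nonneg _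
  have h2 : u ⬝ᵥ u ≠ 0 := fun h => hu (dotProduct_self_eq_zero.1 h)
  rw [unitVector_dotProduct, Real.mul_self_sqrt (by exact_mod_cast h1),
    div_self (by exact_mod_cast h2)]

open ContinuousLinearMap (adjoint)

/-- A truth valuation cannot be concentrated on the range of three isometries with pairwise
orthogonal ranges. -/
theorem IsTruthValuation.complement_ne_zero {w : (H →L[ℂ] H) → ℝ} (hw : IsTruthValuation w)
    {L : Type*} [NormedAddCommGroup L] [InnerProductSpace ℂ L] [CompleteSpace L]
    {V : Fin 3 → (L →L[ℂ] H)} (hV : IsIsometricFamily V) :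
    w (1 - ∑ i, V i ∘L adjoint (V i)) ≠ 0 := by
  intro h0
  refine not_isColoring (fun u => w (combination V (unitVector u) ∘L
    adjoint (combination V (unitVector u))) = 1) fun u v x hu hv hx huv hux hvx => ?_
  let e : Fin 3 → Fin 3 → ℝ := ![unitVector u, unitVector v, unitVector x]
  have he (k) : e k ⬝ᵥ e k = 1 := by
    fin_cases k
    exacts [unitVector_dotProduct_self hu, unitVector_dotProduct_self hv,
      unitVector_dotProduct_self hx]
  have he' (k l) (hkl : k ≠ l) : e k ⬝ᵥ e l = 0 := by
    have h1 : e 0 ⬝ᵥ e 1 = 0 := by simp [e, unitVector_dotProduct, huv]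
    have h2 : e 0 ⬝ᵥ e 2 = 0 := by simp [e, unitVector_dotProduct, hux]
    have h3 : e 1 ⬝ᵥ e 2 = 0 := by simp [e, unitVector_dotProduct, hvx]
    fin_cases k <;> fin_cases l <;>
      first | exact absurd rfl hkl | assumption | (rw [dotProduct_comm]; assumption)
  have hE := hV.combination he he'
  obtain ⟨i, hi, hj⟩ :=
    hw.exists_of_fintype (IsResolution.of_orthogonal hE.isStarProjection hE.mul_eq_zero)
  -- The case `none` is the complement, the same for all frames, whose value is 0 by `h0`.
  rcases i with _ | i
  · simp only [Option.elim_none, sum_combination_comp_adjoint V he he'] at hi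
    exact absurd (h0.symm.trans hi) zero_ne_one
  · have hi' : w (combination V (e i) ∘L adjoint (combination V (e i))) = 1 := hi
    have hj' (j) (h : j ≠ i) : w (combination V (e j) ∘L adjoint (combination V (e j))) = 0 :=
      hj (some j) (by simpa using h)
    constructor
    · fin_cases i
      exacts [.inl hi', .inr (.inl hi'), .inr (.inr hi')]
    · rintro ⟨h1, h2⟩
      by_cases h : 0 = i
      · exact zero_ne_one ((hj' 1 (by simp [← h])).symm.trans h2)
      · exact zero_ne_one ((hj' 0 h).symm.trans h1)

theorem not_isTruthValuation_of_finiteDimensional [FiniteDimensional ℂ H]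
    (hdim : 2 < Module.finrank ℂ H) (w : (H →L[ℂ] H) → ℝ) : ¬ IsTruthValuation w := by
  intro hw
  let b := stdOrthonormalBasis ℂ H
  have hb : IsIsometricFamily fun i => ContinuousLinearMap.toSpanSingleton ℂ (b i) := by
    have h (i j) := b.inner_eq_ite i j
    refine ⟨fun i => ?_, fun i j hij => ?_⟩ <;> ext <;>
      simp [ContinuousLinearMap.adjoint_toSpanSingleton, *]
  have hres : IsResolution fun i => (ContinuousLinearMap.toSpanSingleton ℂ (b i) ∘L
      adjoint (ContinuousLinearMap.toSpanSingleton ℂ (b i)) : H →L[ℂ] H) := by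
    refine ⟨hb.isStarProjection, hb.mul_eq_zero, ?_⟩
    ext x
    simpa [ContinuousLinearMap.adjoint_toSpanSingleton] using b.sum_repr' x
  obtain ⟨i, hi, -⟩ := hw.exists_of_fintype hres
  -- The swap puts the basis vector with value 1 into the triple, which forces the complement to
  -- have value 0.
  obtain ⟨f, hf, hf0⟩ : ∃ f : Fin 3 → Fin (Module.finrank ℂ H), f.Injective ∧ f 0 = i :=
    ⟨Equiv.swap (Fin.castLE hdim 0) i ∘ Fin.castLE hdim,
      (Equiv.injective _).comp (Fin.castLE_injective hdim), Equiv.swap_apply_left _ _⟩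
  have hV : IsIsometricFamily fun k => ContinuousLinearMap.toSpanSingleton ℂ (b (f k)) :=
    ⟨fun k => hb.1 _, fun k l hkl => hb.2 _ _ (hf.ne hkl)⟩
  refine hw.complement_ne_zero hV ?_
  obtain ⟨j, hj, hk⟩ :=
    hw.exists_of_fintype (IsResolution.of_orthogonal hV.isStarProjection hV.mul_eq_zero)
  by_cases h : j = some 0
  · exact hk none (by simp [h])
  · have := hk (some 0) (Ne.symm h)
    simp only [Option.elim_some, hf0] at this
    exact absurd (this.symm.trans hi) zero_ne_one

theorem IsTruthValuation.zero {w : (H →L[ℂ] H) → ℝ} (hw : IsTruthValuation w) : w 0 = 0 := by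
  have h : IsResolution ![(1 : H →L[ℂ] H), 0, 0] := by
    refine ⟨fun i => ?_, fun i j hij => ?_, by simp [Fin.sum_univ_three]⟩
    · fin_cases i
      exacts [.one _, .zero _, .zero _]
    · fin_cases i <;> fin_cases j <;> simp at hij ⊢
  obtain ⟨i, -, hi⟩ := hw 3 _ h
  by_cases h1 : 1 = i
  · exact hi 2 (by simp [← h1])
  · exact hi 1 h1

theorem not_isTruthValuation_of_infinite {ι : Type*} [Infinite ι] (b : HilbertBasis ι ℂ H)
    (w : (H →L[ℂ] H) → ℝ) : ¬ IsTruthValuation w := by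
  classical
  intro hw
  -- Since `3 * #ι = #ι`, the basis splits into three copies of itself. `V i` maps the basis onto
  -- the `i`-th copy.
  obtain ⟨e⟩ : Nonempty (ι × Fin 3 ≃ ι) := by
    rw [← Cardinal.eq]
    simpa using Cardinal.mul_eq_left (Cardinal.aleph0_le_mk ι)
      (Cardinal.natCast_lt_aleph0 (n := 3).le.trans (Cardinal.aleph0_le_mk ι)) (by norm_num)
  have horth (i : Fin 3) : Orthonormal ℂ fun j => b (e (j, i)) :=
    b.orthonormal.comp _ (e.injective.comp (Prod.mk_left_injective i))
  let V (i : Fin 3) : H →L[ℂ] H :=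
    ((horth i).orthogonalFamily.linearIsometry.comp b.repr.toLinearIsometry).toContinuousLinearMap
  have hVb (i : Fin 3) (j : ι) : V i (b j) = b (e (j, i)) := by
    change (horth i).orthogonalFamily.linearIsometry (b.repr (b j)) = _
    rw [b.repr_self, OrthogonalFamily.linearIsometry_apply_single]
    simp
  have hext {S T : H →L[ℂ] H} (h : ∀ j, S (b j) = T (b j)) : S = T := by
    refine ContinuousLinearMap.ext_on (s := Set.range b) ?_ (by rintro _ ⟨j, rfl⟩; exact h j)
    exact Submodule.dense_iff_topologicalClosure_eq_top.2 b.dense_span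
  have hVV (i i' : Fin 3) (j : ι) : adjoint (V i) (V i' (b j)) = if i = i' then b j else 0 := by
    refine b.repr.injective (lp.ext (funext fun k => ?_))
    rw [b.repr_apply_apply, b.repr_apply_apply, ContinuousLinearMap.adjoint_inner_right, hVb, hVb,
      orthonormal_iff_ite.1 b.orthonormal]
    split_ifs with h1 h2 h2
    · obtain ⟨rfl, -⟩ := Prod.mk.inj (e.injective h1)
      rw [orthonormal_iff_ite.1 b.orthonormal, if_pos rfl]
    · exact absurd (Prod.mk.inj (e.injective h1)).2 h2
    · subst h2
      have : k ≠ j := fun h => h1 (by rw [h])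
      rw [orthonormal_iff_ite.1 b.orthonormal, if_neg this]
    · simp
  have hV : IsIsometricFamily V :=
    ⟨fun i => hext fun j => by simp [hVV], fun i i' h => hext fun j => by simp [hVV, h]⟩
  have hsum : ∑ i, (V i ∘L adjoint (V i) : H →L[ℂ] H) = 1 := by
    refine hext fun k => ?_
    obtain ⟨⟨j, i⟩, rfl⟩ := e.surjective k
    rw [← hVb]
    simp only [sum_apply, ContinuousLinearMap.comp_apply, hVV]
    simp [apply_ite (V _)]
  refine hw.complement_ne_zero hV ?_
  rw [hsum, sub_self, hw.zero]

end KochenSpecker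

theorem mainTheorem8 {H : Type*} [NormedAddCommGroup H] [InnerProductSpace ℂ H] [CompleteSpace H]
    (hdim : 2 < Module.rank ℂ H) (Obs : Set (H →ₗ.[ℂ] H))
    (hObs : KochenSpecker.IsObservableSet Obs) :
    KochenSpecker.valuations Obs = ∅ := by
  refine Set.eq_empty_of_forall_notMem fun v hv => ?_
  obtain ⟨w, hw⟩ := KochenSpecker.exists_isTruthValuation hObs hv
  by_cases hfin : FiniteDimensional ℂ H
  · refine KochenSpecker.not_isTruthValuation_of_finiteDimensional ?_ w hw
    rw [← Module.finrank_eq_rank] at hdim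
    exact_mod_cast hdim
  · obtain ⟨s, b, -⟩ := exists_hilbertBasis ℂ H
    rcases finite_or_infinite s with h | h
    · have := Fintype.ofFinite s
      exact hfin (Module.Finite.of_basis b.toOrthonormalBasis.toBasis)
    · exact KochenSpecker.not_isTruthValuation_of_infinite b w hw
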